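/- Let $f:[0,1]^2\to[0,1]$. We say that $f$ satisfies - property $A$ if for all $0\le x\le y\le z\le w\le 1$: $w+x\le y+z \Rightarrow f(x,w)\le f(y,z)$; - property $A'$ if for all $0\le x\le y\le z\le w\le 1$: $w+x\ge y+z \Rightarrow f(x,w)\ge f(y,z)$; - property $B$ if for all $0\le x\le y\le 1$ and $0\le z\le w\le 1$: $f(x,w)-f(x,z)\le f(y,w)-f(y,z)$; - property $B'$ if for all $0\le x\le y\le 1$ and $0\le z\le w\le 1$: $f(x,w)-f(x,z)\ge f(y,w)-f(y,z)$. Consider the following pairs of functions on $[0,1]^2$, each consisting of a well-known $T$-norm $T$ and the corresponding $T$-conorm $T'$. 1. Minimum / maximum: $T=\min(x,y)$; $T'=\max(x,y)$. 2. Product / probabilistic sum: $T=xy$; $T'=x+y-xy$. 3. Łukasiewicz / bounded sum: $T=\max(x+y-1,0)$; $T'=\min(x+y,1)$. 4. Drastic: $T=\min(x,y)$ if $\max(x,y)=1$, otherwise $0$; $T'=\max(x,y)$ if $\min(x,y)=0$, otherwise $1$. 5. Nilpotent minimum / maximum: $T=\min(x,y)$ if $x+y>1$, otherwise $0$; $T'=\max(x,y)$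 if $x+y<1$, otherwise $1$. 6. Dubois–Prade, $\alpha\in[0,1]$: $T=\frac{xy}{\max(x,y,\alpha)}$; $T'=1-\frac{(1-x)(1-y)}{1-\min(x,y,1-\alpha)}$ (with $0/0$ read as $0$). 7. Ali–Mikhail–Haq, $\alpha\in[0,2]$: $T=\frac{xy}{\alpha+(1-\alpha)(x+y-xy)}$ if $\max(x,y)>0$, otherwise $0$; $T'=\frac{x+y+(\alpha-2)xy}{1+(\alpha-1)xy}$ if $\min(x,y)<1$, otherwise $1$. 8. Clayton, $0\ne\alpha\le1$: $T=\max(x^\alpha+y^\alpha-1,0)^{1/\alpha}$ if $\min(x,y)>0$, otherwise $0$; $T'=1-\max((1-x)^\alpha+(1-y)^\alpha-1,0)^{1/\alpha}$ if $\max(x,y)<1$, otherwise $1$. 9. Frank, $0<\alpha\ne1$: $T=\log_\alpha\left(1+\frac{(\alpha^x-1)(\alpha^y-1)}{\alpha-1}\right)$; $T'=1-\log_\alpha\left(1+\frac{(\alpha^{1-x}-1)(\alpha^{1-y}-1)}{\alpha-1}\right)$. 10. Yager, $\alpha\ge1$: $T=\max\left(1-((1-x)^\alpha+(1-y)^\alpha)^{1/\alpha},0\right)$;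 $T'=\min\left((x^\alpha+y^\alpha)^{1/\alpha},1\right)$. 11. Mayor–Torrens, $\alpha\in[0,1]$: $T=\max(x+y-\alpha,0)$ if $0\le x,y\le\alpha$, otherwise $\min(x,y)$; $T'=\min(x+y+\alpha-1,1)$ if $1-\alpha\le x,y\le1$, otherwise $\max(x,y)$. 12. Sugeno–Weber, $\alpha\ge0$: $T=\max\left(\frac{x+y-1+\alpha xy}{1+\alpha},0\right)$; $T'=\min\left(x+y-\frac{\alpha}{1+\alpha}xy,1\right)$. 13. Gumbel, $\alpha\ge1$: $T=e^{-((-\ln x)^\alpha+(-\ln y)^\alpha)^{1/\alpha}}$ if $\min(x,y)>0$, otherwise $0$; $T'=1-e^{-((-\ln(1-x))^\alpha+(-\ln(1-y))^\alpha)^{1/\alpha}}$ if $\max(x,y)<1$, otherwise $1$. 14. Joe, $\alpha\ge1$: $T=1-\left((1-x)^\alpha+(1-y)^\alpha-(1-x)^\alpha(1-y)^\alpha\right)^{1/\alpha}$; $T'=\left(x^\alpha+y^\alpha-x^\alpha y^\alpha\right)^{1/\alpha}$. In every case (and for every admissible $\alpha$) $T$ and $T'$ map $[0,1]^2$ into $[0,1]$,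 and $T'$ is the dual of $T$ with respect to the standard negation, i.e. $T'(x,y)=1-T(1-x,1-y)$. Moreover: - in cases 1–3 and 6–14, for every admissible $\alpha$, $T$ satisfies properties $A$ and $B$, and $T'$ satisfies properties $A'$ and $B'$; - the nilpotent minimum satisfies $A$ but not $B$, and the nilpotent maximum satisfies $A'$ but not $B'$; - the drastic $T$-norm satisfies neither $A$ nor $B$, and the drastic $T$-conorm satisfies neither $A'$ nor $B'$. -/

import Mathlib

/-- `f` restricts to a function `[0,1]² → [0,1]`. -/
def MapsUnitSquare (f : ℝ → ℝ → ℝ) : Prop :=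
  ∀ x y : ℝ, 0 ≤ x → x ≤ 1 → 0 ≤ y → y ≤ 1 → 0 ≤ f x y ∧ f x y ≤ 1

/-- On `[0,1]²`, `g` is the dual of `f` with respect to the standard negation `x ↦ 1 - x`. -/
def IsStdDual (f g : ℝ → ℝ → ℝ) : Prop :=
  ∀ x y : ℝ, 0 ≤ x → x ≤ 1 → 0 ≤ y → y ≤ 1 → g x y = 1 - f (1 - x) (1 - y)

/-- `f` and `g` are functions `[0,1]² → [0,1]`, and `g` is the dual of `f`. -/
def DualPair (f g : ℝ → ℝ → ℝ) : Prop :=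
  MapsUnitSquare f ∧ MapsUnitSquare g ∧ IsStdDual f g

/-- Property `A` of a function on `[0,1]²`. -/
def PropertyA (f : ℝ → ℝ → ℝ) : Prop :=
  ∀ x y z w : ℝ, 0 ≤ x → x ≤ y → y ≤ z → z ≤ w → w ≤ 1 → w + x ≤ y + z → f x w ≤ f y z

/-- Property `A'` of a function on `[0,1]²`. -/
def PropertyA' (f : ℝ → ℝ → ℝ) : Prop :=
  ∀ x y z w : ℝ, 0 ≤ x → x ≤ y → y ≤ z → z ≤ w → w ≤ 1 → w + x ≥ y + z → f x w ≥ f y z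

/-- Property `B` (2-increasing) of a function on `[0,1]²`. -/
def PropertyB (f : ℝ → ℝ → ℝ) : Prop :=
  ∀ x y z w : ℝ, 0 ≤ x → x ≤ y → y ≤ 1 → 0 ≤ z → z ≤ w → w ≤ 1 →
    f x w - f x z ≤ f y w - f y z

/-- Property `B'` of a function on `[0,1]²`. -/
def PropertyB' (f : ℝ → ℝ → ℝ) : Prop :=
  ∀ x y z w : ℝ, 0 ≤ x → x ≤ y → y ≤ 1 → 0 ≤ z → z ≤ w → w ≤ 1 →
    f x w - f x z ≥ f y w - f y z

noncomputable section

/-! The T-norms. Each formula is meant for arguments in `[0,1]`. -/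

namespace TNorm

def minimum (x y : ℝ) : ℝ := min x y

def product (x y : ℝ) : ℝ := x * y

def lukasiewicz (x y : ℝ) : ℝ := max (x + y - 1) 0

def drastic (x y : ℝ) : ℝ := if max x y = 1 then min x y else 0

def nilpotentMin (x y : ℝ) : ℝ := if x + y > 1 then min x y else 0

/-- For `α = 0` and `x = y = 0` the quotient `0 / 0` is read as `0`. -/
def duboisPrade (α x y : ℝ) : ℝ := x * y / max (max x y) α

def aliMikhailHaq (α x y : ℝ) : ℝ :=
  if max x y > 0 then x * y / (α + (1 - α) * (x + y - x * y)) else 0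

/-- For `α < 0` the power `0 ^ α` is `+∞`, and `(+∞) ^ (1 / α) = 0`, so that the value is `0` as
soon as one argument is `0`. For `0 < α ≤ 1` the main formula gives `0` there as well. -/
def clayton (α x y : ℝ) : ℝ :=
  if min x y > 0 then (max (x ^ α + y ^ α - 1) 0) ^ (1 / α) else 0

def frank (α x y : ℝ) : ℝ :=
  Real.logb α (1 + (α ^ x - 1) * (α ^ y - 1) / (α - 1))

def yager (α x y : ℝ) : ℝ :=
  max (1 - ((1 - x) ^ α + (1 - y) ^ α) ^ (1 / α)) 0

def mayorTorrens (α x y : ℝ) : ℝ :=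
  if (0 ≤ x ∧ x ≤ α) ∧ (0 ≤ y ∧ y ≤ α) then max (x + y - α) 0 else min x y

def sugenoWeber (α x y : ℝ) : ℝ :=
  max ((x + y - 1 + α * x * y) / (1 + α)) 0

def gumbel (α x y : ℝ) : ℝ :=
  if min x y > 0 then
    Real.exp (-(((-Real.log x) ^ α + (-Real.log y) ^ α) ^ (1 / α)))
  else 0

def joe (α x y : ℝ) : ℝ :=
  1 - ((1 - x) ^ α + (1 - y) ^ α - (1 - x) ^ α * (1 - y) ^ α) ^ (1 / α)

end TNorm

/-! The T-conorms. Each formula is meant for arguments in `[0,1]`. -/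

namespace TConorm

def maximum (x y : ℝ) : ℝ := max x y

def probabilisticSum (x y : ℝ) : ℝ := x + y - x * y

def boundedSum (x y : ℝ) : ℝ := min (x + y) 1

def drastic (x y : ℝ) : ℝ := if min x y = 0 then max x y else 1

def nilpotentMax (x y : ℝ) : ℝ := if x + y < 1 then max x y else 1

/-- For `α = 0` and `x = y = 1` the quotient `0 / 0` is read as `0`. -/
def duboisPrade (α x y : ℝ) : ℝ :=
  1 - (1 - x) * (1 - y) / (1 - min (min x y) (1 - α))

def aliMikhailHaq (α x y : ℝ) : ℝ :=
  if min x y < 1 then (x + y + (α - 2) * x * y) / (1 + (α - 1) * x * y) else 1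

/-- The value is `1` as soon as one argument is `1`; for `α < 0` this is the usual reading of the
main formula with `0 ^ α = +∞`, and for `0 < α ≤ 1` the main formula gives `1` there as well. -/
def clayton (α x y : ℝ) : ℝ :=
  if max x y < 1 then 1 - (max ((1 - x) ^ α + (1 - y) ^ α - 1) 0) ^ (1 / α) else 1

def frank (α x y : ℝ) : ℝ :=
  1 - Real.logb α (1 + (α ^ (1 - x) - 1) * (α ^ (1 - y) - 1) / (α - 1))

def yager (α x y : ℝ) : ℝ :=
  min ((x ^ α + y ^ α) ^ (1 / α)) 1

def mayorTorrens (α x y : ℝ) : ℝ :=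
  if (1 - α ≤ x ∧ x ≤ 1) ∧ (1 - α ≤ y ∧ y ≤ 1) then min (x + y + α - 1) 1 else max x y

def sugenoWeber (α x y : ℝ) : ℝ :=
  min (x + y - α / (1 + α) * x * y) 1

def gumbel (α x y : ℝ) : ℝ :=
  if max x y < 1 then
    1 - Real.exp (-(((-Real.log (1 - x)) ^ α + (-Real.log (1 - y)) ^ α) ^ (1 / α)))
  else 1

def joe (α x y : ℝ) : ℝ :=
  (x ^ α + y ^ α - x ^ α * y ^ α) ^ (1 / α)

end TConorm

end

open Set

/-! Negation reverses order and sums, so for a commutative `T` the properties `A` and `B` pass to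
`A'` and `B'` of the dual. Every positive case with both properties thus reduces to `T`
(`dual_properties`); the drastic and nilpotent pairs are settled directly, the failures by small
rational counterexamples.

Clayton, Yager, Gumbel and Joe have the form `ψ (φ x + φ y)` with `φ` and `ψ` convex and decreasing.
Convexity of `φ` yields `A`, convexity of `ψ` yields `B` (`archimedean_properties`); each family
then only needs suitable generators.

Dubois–Prade and Mayor–Torrens are ordinal sums. Each splits into a term in the arguments truncated
at `α` plus the minimum of the excesses over `α`, and both terms are 2-increasing.

Property `A` of the product, `mul_le_mul_of_add_le_add_of_le`, is reused for the families built from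
products. Ali–Mikhail–Haq becomes polynomial inequalities after clearing denominators. Frank is the
product conjugated by an increasing bijection of `[0,1]`. -/

theorem mapsUnitSquare_of_isStdDual {f g : ℝ → ℝ → ℝ} (hmap : MapsUnitSquare f)
    (hdual : IsStdDual f g) : MapsUnitSquare g := by
  intro x y hx hx' hy hy'
  have := hmap (1 - x) (1 - y) (by linarith) (by linarith) (by linarith) (by linarith)
  rw [hdual x y hx hx' hy hy']
  constructor <;> linarith

/-- For a commutative `f`, the dual inherits the range and the dual properties. -/
theorem dual_properties {f g : ℝ → ℝ → ℝ} (hmap : MapsUnitSquare f)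
    (hcomm : ∀ x y, f x y = f y x) (hdual : IsStdDual f g)
    (hA : PropertyA f) (hB : PropertyB f) :
    DualPair f g ∧ PropertyA f ∧ PropertyB f ∧ PropertyA' g ∧ PropertyB' g := by
  refine ⟨⟨hmap, mapsUnitSquare_of_isStdDual hmap hdual, hdual⟩, hA, hB, ?_, ?_⟩
  · intro x y z w hx hxy hyz hzw hw h
    rw [hdual x w hx (by linarith) (by linarith) hw,
      hdual y z (by linarith) (by linarith) (by linarith) (by linarith), hcomm (1 - x),
      hcomm (1 - y)]
    -- Negation reverses the chain, which is why commutativity was needed to swap the arguments.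
    have := hA (1 - w) (1 - z) (1 - y) (1 - x) (by linarith) (by linarith) (by linarith)
      (by linarith) (by linarith) (by linarith)
    linarith
  · intro x y z w hx hxy hy hz hzw hw
    rw [hdual x w hx (by linarith) (by linarith) hw, hdual x z hx (by linarith) hz (by linarith),
      hdual y w (by linarith) hy (by linarith) hw, hdual y z (by linarith) hy hz (by linarith)]
    have := hB (1 - y) (1 - x) (1 - w) (1 - z) (by linarith) (by linarith) (by linarith)
      (by linarith) (by linarith) (by linarith)
    linarith

/-! ### Convexity tools in one real variable -/

/-- `y` and `z` are convex combinations of `x` and `w` with interchanged weights, so the weights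
cancel when the two convexity inequalities are added. -/
theorem ConvexOn.add_le_add_of_add_eq {s : Set ℝ} {f : ℝ → ℝ} (hf : ConvexOn ℝ s f)
    {x y z w : ℝ} (hx : x ∈ s) (hw : w ∈ s) (hxy : x ≤ y) (hyw : y ≤ w) (h : x + w = y + z) :
    f y + f z ≤ f x + f w := by
  rcases eq_or_lt_of_le (hxy.trans hyw) with rfl | hlt
  · have hy : y = x := le_antisymm hyw hxy
    have hz : z = x := by linarith
    rw [hy, hz]
  have hd : 0 < w - x := sub_pos.2 hlt
  have hab : (w - y) / (w - x) + (y - x) / (w - x) = 1 := by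
    field_simp; ring
  have ha : 0 ≤ (w - y) / (w - x) := div_nonneg (by linarith) hd.le
  have hb : 0 ≤ (y - x) / (w - x) := div_nonneg (by linarith) hd.le
  have h1 := hf.2 hx hw ha hb hab
  have h2 := hf.2 hx hw hb ha (by rw [add_comm]; exact hab)
  have e1 : ((w - y) / (w - x)) • x + ((y - x) / (w - x)) • w = y := by
    simp only [smul_eq_mul]; field_simp; ring
  have e2 : ((y - x) / (w - x)) • x + ((w - y) / (w - x)) • w = z := by
    obtain rfl : z = x + w - y := by linarith
    simp only [smul_eq_mul]; field_simp; ring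
  rw [e1] at h1
  rw [e2] at h2
  simp only [smul_eq_mul] at h1 h2
  have e3 : (w - y) / (w - x) = 1 - (y - x) / (w - x) := by linarith
  rw [e3] at h1 h2
  linarith

theorem ConvexOn.comp_mapsTo {s t : Set ℝ} {f g : ℝ → ℝ} (hg : ConvexOn ℝ t g)
    (hf : ConvexOn ℝ s f) (hst : MapsTo f s t) (hm : MonotoneOn g t) :
    ConvexOn ℝ s (fun x => g (f x)) :=
  ⟨hf.1, fun _ hx _ hy _ _ ha hb hab =>
    (hm (hst (hf.1 hx hy ha hb hab)) (hg.1 (hst hx) (hst hy) ha hb hab)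
      (hf.2 hx hy ha hb hab)).trans (hg.2 (hst hx) (hst hy) ha hb hab)⟩

theorem ConcaveOn.comp_mapsTo {s t : Set ℝ} {f g : ℝ → ℝ} (hg : ConcaveOn ℝ t g)
    (hf : ConcaveOn ℝ s f) (hst : MapsTo f s t) (hm : MonotoneOn g t) :
    ConcaveOn ℝ s (fun x => g (f x)) :=
  ⟨hf.1, fun _ hx _ hy _ _ ha hb hab =>
    (hg.2 (hst hx) (hst hy) ha hb hab).trans
      (hm (hg.1 (hst hx) (hst hy) ha hb hab) (hst (hf.1 hx hy ha hb hab))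
        (hf.2 hx hy ha hb hab))⟩

theorem ConcaveOn.const_sub {s : Set ℝ} {f : ℝ → ℝ} (hf : ConcaveOn ℝ s f) (c : ℝ) :
    ConvexOn ℝ s (fun x => c - f x) := by
  simp only [sub_eq_add_neg]
  exact (convexOn_const c hf.1).add hf.neg

theorem ConvexOn.const_sub {s : Set ℝ} {f : ℝ → ℝ} (hf : ConvexOn ℝ s f) (c : ℝ) :
    ConcaveOn ℝ s (fun x => c - f x) := by
  simp only [sub_eq_add_neg]
  exact (concaveOn_const c hf.1).add hf.neg

/-- The power is the exponential of a nonnegative multiple of the convex function `-log`. -/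
theorem Real.convexOn_rpow_of_nonpos {p : ℝ} (hp : p ≤ 0) :
    ConvexOn ℝ (Ioi 0) (fun x : ℝ => x ^ p) := by
  have h1 : ConvexOn ℝ (Ioi 0) (fun x : ℝ => (-p) • (-Real.log x)) :=
    (strictConcaveOn_log_Ioi.concaveOn.neg).smul (by linarith)
  refine (convexOn_exp.comp_mapsTo h1 (mapsTo_univ _ _) (Real.exp_monotone.monotoneOn _)).congr ?_
  intro x hx
  simp only [smul_eq_mul, Real.rpow_def_of_pos (mem_Ioi.1 hx)]
  congr 1; ring

/-! ### Functions with convex additive generators -/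

/-- A function on the unit square that vanishes when an argument is zero and is `ψ (φ x + φ y)`
otherwise, with decreasing and convex `φ` and `ψ`. -/
theorem archimedean_properties {f : ℝ → ℝ → ℝ} {φ ψ : ℝ → ℝ}
    (hφ : ConvexOn ℝ (Ioc 0 1) φ) (hφa : AntitoneOn φ (Ioc 0 1)) (hφ0 : ∀ x ∈ Ioc (0 : ℝ) 1, 0 ≤ φ x)
    (hψ : ConvexOn ℝ (Ici 0) ψ) (hψa : AntitoneOn ψ (Ici 0))
    (hψ0 : ∀ t ∈ Ici (0 : ℝ), 0 ≤ ψ t ∧ ψ t ≤ 1)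
    (hf : ∀ x ∈ Ioc (0 : ℝ) 1, ∀ y ∈ Ioc (0 : ℝ) 1, f x y = ψ (φ x + φ y))
    (hl : ∀ x ∈ Icc (0 : ℝ) 1, f 0 x = 0) (hr : ∀ x ∈ Icc (0 : ℝ) 1, f x 0 = 0) :
    MapsUnitSquare f ∧ PropertyA f ∧ PropertyB f := by
  have hmap : MapsUnitSquare f := by
    intro x y hx hx' hy hy'
    rcases hx.eq_or_lt with rfl | hx
    · rw [hl y ⟨hy, hy'⟩]; simp
    rcases hy.eq_or_lt with rfl | hy
    · rw [hr x ⟨hx.le, hx'⟩]; simp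
    rw [hf x ⟨hx, hx'⟩ y ⟨hy, hy'⟩]
    exact hψ0 _ (add_nonneg (hφ0 x ⟨hx, hx'⟩) (hφ0 y ⟨hy, hy'⟩))
  have hanti : ∀ {x y}, 0 < x → x ≤ y → y ≤ 1 → φ y ≤ φ x := fun hx hxy hy =>
    hφa ⟨hx, hxy.trans hy⟩ ⟨hx.trans_le hxy, hy⟩ hxy
  refine ⟨hmap, ?_, ?_⟩
  · intro x y z w hx hxy hyz hzw hw h
    rcases hx.eq_or_lt with rfl | hx
    · rw [hl w ⟨by linarith, hw⟩]
      exact (hmap y z hxy (by linarith) (by linarith) (by linarith)).1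
    have hy := hx.trans_le hxy
    have hz := hy.trans_le hyz
    have hw0 := hz.trans_le hzw
    rw [hf x ⟨hx, by linarith⟩ w ⟨hw0, hw⟩, hf y ⟨hy, by linarith⟩ z ⟨hz, by linarith⟩]
    refine hψa (add_nonneg (hφ0 y ⟨hy, by linarith⟩) (hφ0 z ⟨hz, by linarith⟩))
      (add_nonneg (hφ0 x ⟨hx, by linarith⟩) (hφ0 w ⟨hw0, hw⟩)) ?_
    -- The pair `y`, `z` lies between `y + z - w` and `w`, which have the same sum. The hypothesis
    -- gives `y + z - w ≥ x > 0`, so this point stays in the domain of convexity.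
    have h1 : φ y + φ z ≤ φ (y + z - w) + φ w :=
      hφ.add_le_add_of_add_eq ⟨by linarith, by linarith⟩ ⟨hw0, hw⟩ (by linarith)
        (by linarith) (by ring)
    have h2 : φ (y + z - w) ≤ φ x := hanti hx (by linarith) (by linarith)
    linarith
  -- Used on the boundary: when a side of the rectangle lies on an axis, two corner values vanish
  -- and `B` reduces to monotonicity.
  · have hmono : ∀ x y z w : ℝ, 0 < x → x ≤ y → y ≤ 1 → 0 < z → z ≤ w → w ≤ 1 →
        f x z ≤ f y w := by
      intro x y z w hx hxy hy hz hzw hw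
      have hy0 := hx.trans_le hxy
      have hw0 := hz.trans_le hzw
      rw [hf x ⟨hx, hxy.trans hy⟩ z ⟨hz, hzw.trans hw⟩, hf y ⟨hy0, hy⟩ w ⟨hw0, hw⟩]
      exact hψa (add_nonneg (hφ0 y ⟨hy0, hy⟩) (hφ0 w ⟨hw0, hw⟩))
        (add_nonneg (hφ0 x ⟨hx, hxy.trans hy⟩) (hφ0 z ⟨hz, hzw.trans hw⟩))
        (add_le_add (hanti hx hxy hy) (hanti hz hzw hw))
    intro x y z w hx hxy hy hz hzw hw
    rcases hz.eq_or_lt with rfl | hz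
    · rw [hr x ⟨hx, hxy.trans hy⟩, hr y ⟨hx.trans hxy, hy⟩, sub_zero, sub_zero]
      rcases hx.eq_or_lt with rfl | hx
      · rw [hl w ⟨hzw, hw⟩]
        exact (hmap y w hxy hy hzw hw).1
      rcases hzw.eq_or_lt with rfl | hw0
      · rw [hr x ⟨hx.le, hxy.trans hy⟩, hr y ⟨hx.le.trans hxy, hy⟩]
      exact hmono x y w w hx hxy hy hw0 le_rfl hw
    have hw0 := hz.trans_le hzw
    rcases hx.eq_or_lt with rfl | hx
    · rw [hl w ⟨hw0.le, hw⟩, hl z ⟨hz.le, hzw.trans hw⟩]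
      rcases hxy.eq_or_lt with rfl | hy0
      · rw [hl w ⟨hw0.le, hw⟩, hl z ⟨hz.le, hzw.trans hw⟩]
      linarith [hmono y y z w hy0 le_rfl hy hz hzw hw]
    have hy0 := hx.trans_le hxy
    have hx1 := hxy.trans hy
    have hz1 := hzw.trans hw
    rw [hf x ⟨hx, hx1⟩ w ⟨hw0, hw⟩, hf x ⟨hx, hx1⟩ z ⟨hz, hz1⟩, hf y ⟨hy0, hy⟩ w ⟨hw0, hw⟩,
      hf y ⟨hy0, hy⟩ z ⟨hz, hz1⟩]
    have h1 := hanti hx hxy hy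
    have h2 := hanti hz hzw hw
    -- The arguments of `ψ` at opposite corners have equal sums, and those at the corners `(y, w)`
    -- and `(x, z)` are the extreme ones.
    have := hψ.add_le_add_of_add_eq (x := φ y + φ w) (y := φ x + φ w) (z := φ y + φ z)
      (w := φ x + φ z) (add_nonneg (hφ0 y ⟨hy0, hy⟩) (hφ0 w ⟨hw0, hw⟩))
      (add_nonneg (hφ0 x ⟨hx, hx1⟩) (hφ0 z ⟨hz, hz1⟩)) (by linarith) (by linarith) (by ring)
    linarith

/-! ### Parameter-free pairs -/

theorem minimum_case : DualPair TNorm.minimum TConorm.maximum ∧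
      PropertyA TNorm.minimum ∧ PropertyB TNorm.minimum ∧
      PropertyA' TConorm.maximum ∧ PropertyB' TConorm.maximum := by
  refine dual_properties ?_ (fun x y => min_comm x y) ?_ ?_ ?_
  · intro x y; unfold TNorm.minimum; grind
  · intro x y; unfold TNorm.minimum TConorm.maximum; grind
  · intro x y z w; unfold TNorm.minimum; grind
  · intro x y z w; unfold TNorm.minimum; grind

/-- `y * z - x * w = (w - y) * (w - z) + w * (y + z - w - x)`, with both terms nonnegative. -/
theorem mul_le_mul_of_add_le_add_of_le {x y z w : ℝ} (hx : 0 ≤ x) (hxy : x ≤ y) (hyz : y ≤ z)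
    (hzw : z ≤ w) (h : w + x ≤ y + z) : x * w ≤ y * z := by
  nlinarith [mul_nonneg (sub_nonneg.2 (hyz.trans hzw)) (sub_nonneg.2 hzw),
      mul_nonneg (by linarith : 0 ≤ w) (by linarith : 0 ≤ y + z - w - x)]

theorem product_case : DualPair TNorm.product TConorm.probabilisticSum ∧
      PropertyA TNorm.product ∧ PropertyB TNorm.product ∧
      PropertyA' TConorm.probabilisticSum ∧ PropertyB' TConorm.probabilisticSum := by
  refine dual_properties ?_ (fun x y => mul_comm x y) ?_ ?_ ?_
  · intro x y hx hx' hy hy'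
    exact ⟨mul_nonneg hx hy, mul_le_one₀ hx' hy hy'⟩
  · intro x y _ _ _ _; unfold TNorm.product TConorm.probabilisticSum; ring
  · intro x y z w hx hxy hyz hzw hw h
    exact mul_le_mul_of_add_le_add_of_le hx hxy hyz hzw h
  · intro x y z w hx hxy hy hz hzw hw; unfold TNorm.product
    nlinarith [mul_nonneg (sub_nonneg.2 hxy) (sub_nonneg.2 hzw)]

theorem lukasiewicz_case : DualPair TNorm.lukasiewicz TConorm.boundedSum ∧
      PropertyA TNorm.lukasiewicz ∧ PropertyB TNorm.lukasiewicz ∧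
      PropertyA' TConorm.boundedSum ∧ PropertyB' TConorm.boundedSum := by
  refine dual_properties ?_ (fun x y => ?_) ?_ ?_ ?_
  · intro x y; unfold TNorm.lukasiewicz; grind
  · unfold TNorm.lukasiewicz; rw [add_comm]
  · intro x y; unfold TNorm.lukasiewicz TConorm.boundedSum; grind
  · intro x y z w; unfold TNorm.lukasiewicz; grind
  · intro x y z w; unfold TNorm.lukasiewicz; grind

theorem drastic_case : DualPair TNorm.drastic TConorm.drastic ∧
      ¬ PropertyA TNorm.drastic ∧ ¬ PropertyB TNorm.drastic ∧
      ¬ PropertyA' TConorm.drastic ∧ ¬ PropertyB' TConorm.drastic := by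
  have hmap : MapsUnitSquare TNorm.drastic := by
    intro x y; unfold TNorm.drastic; grind
  have hdual : IsStdDual TNorm.drastic TConorm.drastic := by
    intro x y; unfold TNorm.drastic TConorm.drastic; grind
  refine ⟨⟨hmap, mapsUnitSquare_of_isStdDual hmap hdual, hdual⟩, fun h => ?_, fun h => ?_,
    fun h => ?_, fun h => ?_⟩
  -- The counterexamples exploit the jump of `T` at the edges where an argument is `1`, and that of
  -- `T'` at the edges where an argument is `0`.
  · have := h (1/2) (3/4) (3/4) 1
    unfold TNorm.drastic at this
    norm_num at this
  · have := h (3/4) 1 (3/4) 1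
    unfold TNorm.drastic at this
    norm_num at this
  · have := h 0 (1/4) (1/4) (1/2)
    unfold TConorm.drastic at this
    norm_num at this
  · have := h 0 (1/4) 0 (1/4)
    unfold TConorm.drastic at this
    norm_num at this

theorem nilpotent_case : DualPair TNorm.nilpotentMin TConorm.nilpotentMax ∧
      PropertyA TNorm.nilpotentMin ∧ ¬ PropertyB TNorm.nilpotentMin ∧
      PropertyA' TConorm.nilpotentMax ∧ ¬ PropertyB' TConorm.nilpotentMax := by
  have hmap : MapsUnitSquare TNorm.nilpotentMin := by
    intro x y; unfold TNorm.nilpotentMin; grind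
  have hdual : IsStdDual TNorm.nilpotentMin TConorm.nilpotentMax := by
    intro x y; unfold TNorm.nilpotentMin TConorm.nilpotentMax; grind
  refine ⟨⟨hmap, mapsUnitSquare_of_isStdDual hmap hdual, hdual⟩, fun x y z w => ?_, fun h => ?_,
    fun x y z w => ?_, fun h => ?_⟩
  · unfold TNorm.nilpotentMin; grind
  -- Only the lowest corner lies on the line `x + y = 1`, where the value is still `0`.
  · have := h (1/2) (3/4) (1/2) (3/4)
    unfold TNorm.nilpotentMin at this
    norm_num at this
  · unfold TConorm.nilpotentMax; grind
  -- Only the top corner lies on the line `x + y = 1`, where the value is already `1`.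
  · have := h (1/4) (1/2) (1/4) (1/2)
    unfold TConorm.nilpotentMax at this
    norm_num at this

/-! ### Ordinal sums: Dubois–Prade and Mayor–Torrens -/

theorem min_sub_min_le {a b c d : ℝ} (hab : a ≤ b) (hcd : c ≤ d) :
    min a d - min a c ≤ min b d - min b c := by
  grind

/-- Ordinal sum decomposition: the product rescaled to `[0, α]` plus the minimum above `α`. For `α =
0` the first term vanishes and the minimum remains. -/
theorem duboisPrade_eq_add {α x y : ℝ} (hα : 0 ≤ α) (hx : 0 ≤ x) (hy : 0 ≤ y) :
    TNorm.duboisPrade α x y =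
      min x α * min y α / α + min (max (x - α) 0) (max (y - α) 0) := by
  unfold TNorm.duboisPrade
  rcases le_or_gt x α with h1 | h1 <;> rcases le_or_gt y α with h2 | h2
  · rw [max_eq_right (max_le h1 h2), min_eq_left h1, min_eq_left h2,
      max_eq_right (sub_nonpos.2 h1), max_eq_right (sub_nonpos.2 h2)]
    simp
  · rw [max_eq_right (h1.trans h2.le), max_eq_left h2.le, min_eq_left h1, min_eq_right h2.le,
      max_eq_right (sub_nonpos.2 h1), min_eq_left (le_max_right _ _),
      mul_div_cancel_right₀ _ (by linarith)]
    rcases hα.eq_or_lt with rfl | hα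
    · simp; linarith
    · rw [mul_div_cancel_right₀ _ hα.ne', add_zero]
  · rw [max_eq_left (h2.trans h1.le), max_eq_left h1.le, min_eq_left h2, min_eq_right h1.le,
      max_eq_right (sub_nonpos.2 h2), min_eq_right (le_max_right _ _),
      mul_div_cancel_left₀ _ (by linarith)]
    rcases hα.eq_or_lt with rfl | hα
    · simp; linarith
    · rw [mul_div_cancel_left₀ _ hα.ne', add_zero]
  · rw [min_eq_right h1.le, min_eq_right h2.le, mul_self_div_self,
      max_eq_left (sub_nonneg.2 h1.le), max_eq_left (sub_nonneg.2 h2.le),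
      max_eq_left (h1.le.trans (le_max_left _ _)), min_sub_sub_right]
    rcases le_total x y with h | h
    · rw [max_eq_right h, min_eq_left h, mul_div_cancel_right₀ _ (by linarith)]; ring
    · rw [max_eq_left h, min_eq_right h, mul_div_cancel_left₀ _ (by linarith)]; ring

theorem duboisPrade_case {α : ℝ} (hα : 0 ≤ α) (hα1 : α ≤ 1) :
      DualPair (TNorm.duboisPrade α) (TConorm.duboisPrade α) ∧
      PropertyA (TNorm.duboisPrade α) ∧ PropertyB (TNorm.duboisPrade α) ∧
      PropertyA' (TConorm.duboisPrade α) ∧ PropertyB' (TConorm.duboisPrade α) := by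
  refine dual_properties ?_ (fun x y => ?_) ?_ ?_ ?_
  · intro x y hx hx' hy hy'
    unfold TNorm.duboisPrade
    refine ⟨by positivity, div_le_one_of_le₀ ?_ (by positivity)⟩
    exact (mul_le_of_le_one_right hx hy').trans ((le_max_left _ _).trans (le_max_left _ _))
  · unfold TNorm.duboisPrade; rw [mul_comm, max_comm x]
  · intro x y _ _ _ _
    unfold TNorm.duboisPrade TConorm.duboisPrade
    congr 2; grind
  · intro x y z w hx hxy hyz hzw hw h
    rw [duboisPrade_eq_add hα hx (by linarith), duboisPrade_eq_add hα (by linarith) (by linarith)]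
    rcases le_or_gt w α with h1 | h1
    · have := mul_le_mul_of_add_le_add_of_le hx hxy hyz hzw h
      rw [show min x α = x by grind, show min y α = y by grind, show min z α = z by grind,
        show min w α = w by grind, show min (max (x - α) 0) (max (w - α) 0) = 0 by grind,
        show min (max (y - α) 0) (max (z - α) 0) = 0 by grind]
      gcongr
    · rcases hα.eq_or_lt with rfl | hα
      · simp; grind
      rw [min_eq_right h1.le, mul_div_cancel_right₀ _ hα.ne']
      -- If `z ≤ α < w`, the claim is the product inequality with `w` replaced by `α`. If `α < z`,
      -- the two sides are just `x` and `y`.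
      rcases le_or_gt z α with h2 | h2
      · rw [show min x α = x by grind, show min y α = y by grind, show min z α = z by grind,
          show min (max (x - α) 0) (max (w - α) 0) = 0 by grind,
          show min (max (y - α) 0) (max (z - α) 0) = 0 by grind, add_zero, add_zero,
          le_div_iff₀ hα]
        nlinarith [mul_nonneg (sub_nonneg.2 (hyz.trans h2)) (sub_nonneg.2 h2),
          mul_nonneg hα.le (by linarith : 0 ≤ y + z - α - x)]
      · rw [min_eq_right h2.le, mul_div_cancel_right₀ _ hα.ne']
        grind
  · intro x y z w hx hxy hy hz hzw hw
    have hy0 := hx.trans hxy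
    have hw0 := hz.trans hzw
    rw [duboisPrade_eq_add hα hx hw0, duboisPrade_eq_add hα hx hz, duboisPrade_eq_add hα hy0 hw0,
      duboisPrade_eq_add hα hy0 hz]
    have h1 : max (x - α) 0 ≤ max (y - α) 0 := by gcongr
    have h2 : max (z - α) 0 ≤ max (w - α) 0 := by gcongr
    have h3 := min_sub_min_le h1 h2
    have h4 : 0 ≤ (min y α - min x α) * (min w α - min z α) / α := by
      refine div_nonneg (mul_nonneg (sub_nonneg.2 ?_) (sub_nonneg.2 ?_)) hα <;> gcongr
    have h5 : (min y α - min x α) * (min w α - min z α) / α =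
      min y α * min w α / α - min x α * min w α / α - min y α * min z α / α +
        min x α * min z α / α := by ring
    linarith

/-- The same decomposition, with the Łukasiewicz norm rescaled to `[0, α]` in place of the product.
-/
theorem mayorTorrens_eq_add {α x y : ℝ} (hα : 0 ≤ α) (hx : 0 ≤ x) (hy : 0 ≤ y) :
    TNorm.mayorTorrens α x y =
      max (min x α + min y α - α) 0 + min (max (x - α) 0) (max (y - α) 0) := by
  unfold TNorm.mayorTorrens
  grind

theorem mayorTorrens_case {α : ℝ} (hα : 0 ≤ α) :
      DualPair (TNorm.mayorTorrens α) (TConorm.mayorTorrens α) ∧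
      PropertyA (TNorm.mayorTorrens α) ∧ PropertyB (TNorm.mayorTorrens α) ∧
      PropertyA' (TConorm.mayorTorrens α) ∧ PropertyB' (TConorm.mayorTorrens α) := by
  refine dual_properties ?_ (fun x y => ?_) ?_ ?_ ?_
  · intro x y; unfold TNorm.mayorTorrens; grind
  · unfold TNorm.mayorTorrens; grind
  · intro x y; unfold TNorm.mayorTorrens TConorm.mayorTorrens; grind
  · intro x y z w; unfold TNorm.mayorTorrens; grind
  · intro x y z w hx hxy hy hz hzw hw
    have hy0 := hx.trans hxy
    have hw0 := hz.trans hzw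
    rw [mayorTorrens_eq_add hα hx hw0, mayorTorrens_eq_add hα hx hz,
      mayorTorrens_eq_add hα hy0 hw0, mayorTorrens_eq_add hα hy0 hz]
    have h1 : max (x - α) 0 ≤ max (y - α) 0 := by gcongr
    have h2 : max (z - α) 0 ≤ max (w - α) 0 := by gcongr
    have h3 := min_sub_min_le h1 h2
    have h4 : min x α ≤ min y α := by gcongr
    have h5 : min z α ≤ min w α := by gcongr
    have h6 : max (min x α + min w α - α) 0 - max (min x α + min z α - α) 0 ≤
      max (min y α + min w α - α) 0 - max (min y α + min z α - α) 0 := by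
      generalize min x α = a at *
      generalize min y α = b at *
      generalize min z α = c at *
      generalize min w α = d at *
      clear h1 h2 h3
      grind
    linarith

/-! ### Sugeno–Weber -/

theorem sugenoWeber_case {α : ℝ} (hα : 0 ≤ α) :
      DualPair (TNorm.sugenoWeber α) (TConorm.sugenoWeber α) ∧
      PropertyA (TNorm.sugenoWeber α) ∧ PropertyB (TNorm.sugenoWeber α) ∧
      PropertyA' (TConorm.sugenoWeber α) ∧ PropertyB' (TConorm.sugenoWeber α) := by
  have hα1 : 0 < 1 + α := by linarith
  refine dual_properties ?_ (fun x y => ?_) ?_ ?_ ?_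
  · intro x y hx hx' hy hy'
    unfold TNorm.sugenoWeber
    refine ⟨le_max_right _ _, max_le ((div_le_one hα1).2 ?_) zero_le_one⟩
    have := mul_le_one₀ hx' hy hy'
    nlinarith
  · unfold TNorm.sugenoWeber; congr 2; ring
  · intro x y _ _ _ _
    unfold TNorm.sugenoWeber TConorm.sugenoWeber
    have : (1 - x + (1 - y) - 1 + α * (1 - x) * (1 - y)) / (1 + α) =
      1 - (x + y - α / (1 + α) * x * y) := by field_simp; ring
    rw [this]; grind
  · intro x y z w hx hxy hyz hzw hw h; unfold TNorm.sugenoWeber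
    have := mul_le_mul_of_nonneg_left (mul_le_mul_of_add_le_add_of_le hx hxy hyz hzw h) hα
    gcongr max (?_ / _) _
    linarith
  · intro x y z w hx hxy hy hz hzw hw; unfold TNorm.sugenoWeber
    have hy0 := hx.trans hxy
    have hw0 := hz.trans hzw
    -- Truncation at `0` is convex and increasing, so it preserves 2-increasingness of a function
    -- that is also increasing in each variable.
    have h1 : (x + w - 1 + α * x * w) / (1 + α) ≤ (y + w - 1 + α * y * w) / (1 + α) := by gcongr
    have h2 : (y + z - 1 + α * y * z) / (1 + α) ≤ (y + w - 1 + α * y * w) / (1 + α) := by gcongr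
    have h3 : (x + w - 1 + α * x * w) / (1 + α) + (y + z - 1 + α * y * z) / (1 + α) ≤
        (y + w - 1 + α * y * w) / (1 + α) + (x + z - 1 + α * x * z) / (1 + α) := by
      rw [← add_div, ← add_div]
      gcongr ?_ / _
      nlinarith [mul_nonneg hα (mul_nonneg (sub_nonneg.2 hxy) (sub_nonneg.2 hzw))]
    generalize (x + w - 1 + α * x * w) / (1 + α) = a at *
    generalize (y + w - 1 + α * y * w) / (1 + α) = b at *
    generalize (y + z - 1 + α * y * z) / (1 + α) = c at *
    generalize (x + z - 1 + α * x * z) / (1 + α) = d at *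
    grind

/-! ### Families with convex generators: Clayton, Yager, Gumbel, Joe -/

theorem ConvexOn.max_zero {s : Set ℝ} {f : ℝ → ℝ} (hf : ConvexOn ℝ s f) :
    ConvexOn ℝ s (fun x => max (f x) 0) :=
  hf.sup (convexOn_const 0 hf.1)

theorem convexOn_one_sub {s : Set ℝ} (hs : Convex ℝ s) : ConvexOn ℝ s (fun x => 1 - x) :=
  (concaveOn_id hs).const_sub 1

theorem clayton_zero_left (α x : ℝ) : TNorm.clayton α 0 x = 0 :=
  if_neg fun h => (lt_min_iff.1 h).1.false

theorem clayton_zero_right (α x : ℝ) : TNorm.clayton α x 0 = 0 :=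
  if_neg fun h => (lt_min_iff.1 h).2.false

theorem clayton_of_pos {α x y : ℝ} (hx : 0 < x) (hy : 0 < y) :
    TNorm.clayton α x y = (max (x ^ α + y ^ α - 1) 0) ^ (1 / α) :=
  if_pos (lt_min hx hy)

/-- `0 < α ≤ 1` makes `x ^ α` concave and `1 / α ≥ 1`, so both generators are convex. -/
theorem clayton_tnorm_of_pos {α : ℝ} (h0 : 0 < α) (h1 : α ≤ 1) :
    MapsUnitSquare (TNorm.clayton α) ∧ PropertyA (TNorm.clayton α) ∧
      PropertyB (TNorm.clayton α) := by
  have hinv : 1 ≤ 1 / α := (one_le_div h0).2 h1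
  refine archimedean_properties (φ := fun x => 1 - x ^ α)
    (ψ := fun t => (max (1 - t) 0) ^ (1 / α)) ?_ ?_ ?_ ?_ ?_ ?_ ?_
    (fun x _ => clayton_zero_left α x) (fun x _ => clayton_zero_right α x)
  · exact ((Real.concaveOn_rpow h0.le h1).subset (fun x hx => hx.1.le) (convex_Ioc _ _)).const_sub 1
  · intro x hx y _ hxy
    exact sub_le_sub_left (Real.rpow_le_rpow hx.1.le hxy h0.le) _
  · intro x hx
    exact sub_nonneg.2 (Real.rpow_le_one hx.1.le hx.2 h0.le)
  · exact (convexOn_rpow hinv).comp_mapsTo (convexOn_one_sub (convex_Ici 0)).max_zero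
      (fun x _ => mem_Ici.2 (le_max_right _ _))
      (Real.monotoneOn_rpow_Ici_of_exponent_nonneg (by linarith))
  · intro x _ y _ hxy
    exact Real.rpow_le_rpow (le_max_right _ _) (by gcongr) (by linarith)
  · intro t ht
    have ht : 0 ≤ t := ht
    exact ⟨Real.rpow_nonneg (le_max_right _ _) _,
      Real.rpow_le_one (le_max_right _ _) (max_le (by linarith) zero_le_one) (by linarith)⟩
  · intro x hx y hy
    rw [clayton_of_pos hx.1 hy.1]
    congr 2; ring

/-- The generator changes sign so as to stay decreasing, and it blows up at `0`. The truncation is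
never active, since both powers are at least `1`. -/
theorem clayton_tnorm_of_neg {α : ℝ} (h0 : α < 0) :
    MapsUnitSquare (TNorm.clayton α) ∧ PropertyA (TNorm.clayton α) ∧
      PropertyB (TNorm.clayton α) := by
  have hinv : 1 / α ≤ 0 := one_div_nonpos.2 h0.le
  have hone : ∀ x ∈ Ioc (0 : ℝ) 1, 1 ≤ x ^ α := fun x hx =>
    Real.one_le_rpow_of_pos_of_le_one_of_nonpos hx.1 hx.2 h0.le
  refine archimedean_properties (φ := fun x => x ^ α - 1)
    (ψ := fun t => (1 + t) ^ (1 / α)) ?_ ?_ ?_ ?_ ?_ ?_ ?_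
    (fun x _ => clayton_zero_left α x) (fun x _ => clayton_zero_right α x)
  · exact ((Real.convexOn_rpow_of_nonpos h0.le).subset (fun x hx => hx.1)
      (convex_Ioc _ _)).add_const (-1)
  · intro x hx y _ hxy
    exact sub_le_sub_right (Real.rpow_le_rpow_of_nonpos hx.1 hxy h0.le) _
  · intro x hx
    exact sub_nonneg.2 (hone x hx)
  · refine ⟨convex_Ici 0, fun x hx y hy a b ha hb hab => ?_⟩
    have hx : 0 ≤ x := hx
    have hy : 0 ≤ y := hy
    have := (Real.convexOn_rpow_of_nonpos hinv).2 (x := 1 + x) (y := 1 + y) (mem_Ioi.2 (by linarith))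
      (mem_Ioi.2 (by linarith)) ha hb hab
    have e : 1 + (a • x + b • y) = a • (1 + x) + b • (1 + y) := by
      simp only [smul_eq_mul]; linear_combination -hab
    simp only [e]
    exact this
  · intro x hx y _ hxy
    have hx : 0 ≤ x := hx
    exact Real.rpow_le_rpow_of_nonpos (by linarith) (by linarith) hinv
  · intro t ht
    have ht : 0 ≤ t := ht
    exact ⟨Real.rpow_nonneg (by linarith) _,
      Real.rpow_le_one_of_one_le_of_nonpos (by linarith) hinv⟩
  · intro x hx y hy
    have h1 := hone x hx
    have h2 := hone y hy
    rw [clayton_of_pos hx.1 hy.1, max_eq_left (by linarith)]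
    congr 1; ring

theorem clayton_case {α : ℝ} (h0 : α ≠ 0) (h1 : α ≤ 1) :
      DualPair (TNorm.clayton α) (TConorm.clayton α) ∧
      PropertyA (TNorm.clayton α) ∧ PropertyB (TNorm.clayton α) ∧
      PropertyA' (TConorm.clayton α) ∧ PropertyB' (TConorm.clayton α) := by
  have h : MapsUnitSquare (TNorm.clayton α) ∧ PropertyA (TNorm.clayton α) ∧
      PropertyB (TNorm.clayton α) := by
    rcases h0.lt_or_gt with h | h
    · exact clayton_tnorm_of_neg h
    · exact clayton_tnorm_of_pos h h1
  refine dual_properties h.1 (fun x y => ?_) ?_ h.2.1 h.2.2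
  · unfold TNorm.clayton; rw [min_comm, add_comm (x ^ α)]
  · intro x y _ _ _ _
    unfold TNorm.clayton TConorm.clayton
    grind

theorem yager_case {α : ℝ} (h1 : 1 ≤ α) :
      DualPair (TNorm.yager α) (TConorm.yager α) ∧
      PropertyA (TNorm.yager α) ∧ PropertyB (TNorm.yager α) ∧
      PropertyA' (TConorm.yager α) ∧ PropertyB' (TConorm.yager α) := by
  have h0 : 0 < α := by linarith
  have hinv0 : 0 ≤ 1 / α := by positivity
  have hinv1 : 1 / α ≤ 1 := (div_le_one h0).2 h1
  have hcomm : ∀ x y, TNorm.yager α x y = TNorm.yager α y x := fun x y => by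
    unfold TNorm.yager; rw [add_comm]
  have hl : ∀ x ∈ Icc (0 : ℝ) 1, TNorm.yager α 0 x = 0 := by
    intro x hx
    unfold TNorm.yager
    refine max_eq_right (sub_nonpos.2 (Real.one_le_rpow ?_ hinv0))
    simpa using Real.rpow_nonneg (sub_nonneg.2 hx.2) α
  have h : MapsUnitSquare (TNorm.yager α) ∧ PropertyA (TNorm.yager α) ∧
      PropertyB (TNorm.yager α) := by
    refine archimedean_properties (φ := fun x => (1 - x) ^ α)
      (ψ := fun t => max (1 - t ^ (1 / α)) 0) ?_ ?_ ?_ ?_ ?_ ?_ (fun x _ y _ => rfl)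
      hl (fun x hx => (hcomm x 0).trans (hl x hx))
    · exact (convexOn_rpow h1).comp_mapsTo (convexOn_one_sub (convex_Ioc 0 1))
        (fun x hx => sub_nonneg.2 hx.2) (Real.monotoneOn_rpow_Ici_of_exponent_nonneg h0.le)
    · intro x _ y hy hxy
      exact Real.rpow_le_rpow (sub_nonneg.2 hy.2) (by linarith) h0.le
    · intro x hx
      exact Real.rpow_nonneg (sub_nonneg.2 hx.2) _
    · exact ((Real.concaveOn_rpow hinv0 hinv1).const_sub 1).max_zero
    · intro x hx y _ hxy
      have := Real.rpow_le_rpow hx hxy hinv0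
      exact max_le_max (by linarith) le_rfl
    · intro t ht
      have := Real.rpow_nonneg ht (1 / α)
      exact ⟨le_max_right _ _, max_le (by linarith) zero_le_one⟩
  refine dual_properties h.1 hcomm ?_ h.2.1 h.2.2
  intro x y _ _ _ _
  unfold TNorm.yager TConorm.yager
  simp only [sub_sub_cancel]
  grind

theorem gumbel_case {α : ℝ} (h1 : 1 ≤ α) :
      DualPair (TNorm.gumbel α) (TConorm.gumbel α) ∧
      PropertyA (TNorm.gumbel α) ∧ PropertyB (TNorm.gumbel α) ∧
      PropertyA' (TConorm.gumbel α) ∧ PropertyB' (TConorm.gumbel α) := by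
  have h0 : 0 < α := by linarith
  have hinv0 : 0 ≤ 1 / α := by positivity
  have hinv1 : 1 / α ≤ 1 := (div_le_one h0).2 h1
  have hlog : ∀ x ∈ Ioc (0 : ℝ) 1, 0 ≤ -Real.log x := fun x hx =>
    neg_nonneg.2 (Real.log_nonpos hx.1.le hx.2)
  have h : MapsUnitSquare (TNorm.gumbel α) ∧ PropertyA (TNorm.gumbel α) ∧
      PropertyB (TNorm.gumbel α) := by
    refine archimedean_properties (φ := fun x => (-Real.log x) ^ α)
      (ψ := fun t => Real.exp (-(t ^ (1 / α)))) ?_ ?_ ?_ ?_ ?_ ?_ ?_ ?_ ?_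
    · exact (convexOn_rpow h1).comp_mapsTo ((strictConcaveOn_log_Ioi.concaveOn.neg).subset
        (fun x hx => hx.1) (convex_Ioc 0 1)) hlog
        (Real.monotoneOn_rpow_Ici_of_exponent_nonneg h0.le)
    · intro x hx y hy hxy
      exact Real.rpow_le_rpow (hlog y hy) (neg_le_neg (Real.log_le_log hx.1 hxy)) h0.le
    · intro x hx
      exact Real.rpow_nonneg (hlog x hx) _
    · exact convexOn_exp.comp_mapsTo (Real.concaveOn_rpow hinv0 hinv1).neg (mapsTo_univ _ _)
        (Real.exp_monotone.monotoneOn _)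
    · intro x hx y _ hxy
      exact Real.exp_le_exp.2 (neg_le_neg (Real.rpow_le_rpow hx hxy hinv0))
    · intro t ht
      exact ⟨(Real.exp_pos _).le, Real.exp_le_one_iff.2 (neg_nonpos.2 (Real.rpow_nonneg ht _))⟩
    · intro x hx y hy
      exact if_pos (lt_min hx.1 hy.1)
    · exact fun x _ => if_neg fun h => (lt_min_iff.1 h).1.false
    · exact fun x _ => if_neg fun h => (lt_min_iff.1 h).2.false
  refine dual_properties h.1 (fun x y => ?_) ?_ h.2.1 h.2.2
  · unfold TNorm.gumbel; rw [min_comm, add_comm ((-Real.log x) ^ α)]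
  · intro x y _ _ _ _
    unfold TNorm.gumbel TConorm.gumbel
    grind

theorem joe_case {α : ℝ} (h1 : 1 ≤ α) :
      DualPair (TNorm.joe α) (TConorm.joe α) ∧
      PropertyA (TNorm.joe α) ∧ PropertyB (TNorm.joe α) ∧
      PropertyA' (TConorm.joe α) ∧ PropertyB' (TConorm.joe α) := by
  have h0 : 0 < α := by linarith
  have hinv0 : 0 ≤ 1 / α := by positivity
  have hinv1 : 1 / α ≤ 1 := (div_le_one h0).2 h1
  have hcomm : ∀ x y, TNorm.joe α x y = TNorm.joe α y x := fun x y => by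
    unfold TNorm.joe; rw [add_comm, mul_comm]
  have hl : ∀ x ∈ Icc (0 : ℝ) 1, TNorm.joe α 0 x = 0 := by
    intro x _
    simp [TNorm.joe]
  have hpos : ∀ x ∈ Ioc (0 : ℝ) 1, 0 < 1 - (1 - x) ^ α := fun x hx =>
    sub_pos.2 (Real.rpow_lt_one (sub_nonneg.2 hx.2) (by linarith [hx.1]) h0)
  have hle : ∀ x ∈ Ioc (0 : ℝ) 1, 1 - (1 - x) ^ α ≤ 1 := fun x hx =>
    sub_le_self _ (Real.rpow_nonneg (sub_nonneg.2 hx.2) _)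
  have hexp : ∀ t ∈ Ici (0 : ℝ), 0 ≤ 1 - Real.exp (-t) := fun t ht =>
    sub_nonneg.2 (Real.exp_le_one_iff.2 (neg_nonpos.2 ht))
  have h : MapsUnitSquare (TNorm.joe α) ∧ PropertyA (TNorm.joe α) ∧
      PropertyB (TNorm.joe α) := by
    -- Joe's expression is `1 - (1 - (1 - x) ^ α) * (1 - (1 - y) ^ α)`; the logarithm turns this
    -- multiplicative generator into an additive one.
    refine archimedean_properties (φ := fun x => -Real.log (1 - (1 - x) ^ α))
      (ψ := fun t => 1 - (1 - Real.exp (-t)) ^ (1 / α)) ?_ ?_ ?_ ?_ ?_ ?_ ?_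
      hl (fun x hx => (hcomm x 0).trans (hl x hx))
    · have hc : ConcaveOn ℝ (Ioc 0 1) (fun x : ℝ => 1 - (1 - x) ^ α) :=
        ((convexOn_rpow h1).comp_mapsTo (convexOn_one_sub (convex_Ioc 0 1))
          (fun x hx => sub_nonneg.2 hx.2)
          (Real.monotoneOn_rpow_Ici_of_exponent_nonneg h0.le)).const_sub 1
      exact (strictConcaveOn_log_Ioi.concaveOn.comp_mapsTo hc hpos
        Real.strictMonoOn_log.monotoneOn).neg
    · intro x hx y hy hxy
      exact neg_le_neg (Real.log_le_log (hpos x hx) (sub_le_sub_left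
        (Real.rpow_le_rpow (sub_nonneg.2 hy.2) (by linarith) h0.le) _))
    · intro x hx
      exact neg_nonneg.2 (Real.log_nonpos (hpos x hx).le (hle x hx))
    · have hc : ConcaveOn ℝ (Ici 0) (fun t : ℝ => 1 - Real.exp (-t)) :=
        (convexOn_exp.comp_mapsTo (concaveOn_id (convex_Ici 0)).neg (mapsTo_univ _ _)
          (Real.exp_monotone.monotoneOn _)).const_sub 1
      exact ((Real.concaveOn_rpow hinv0 hinv1).comp_mapsTo hc hexp
        (Real.monotoneOn_rpow_Ici_of_exponent_nonneg hinv0)).const_sub 1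
    · intro x hx y _ hxy
      exact sub_le_sub_left (Real.rpow_le_rpow (hexp x hx)
        (sub_le_sub_left (Real.exp_le_exp.2 (neg_le_neg hxy)) _) hinv0) _
    · intro t ht
      exact ⟨sub_nonneg.2 (Real.rpow_le_one (hexp t ht)
        (sub_le_self _ (Real.exp_pos _).le) hinv0),
        sub_le_self _ (Real.rpow_nonneg (hexp t ht) _)⟩
    · intro x hx y hy
      unfold TNorm.joe
      simp only [neg_add, neg_neg, Real.exp_add, Real.exp_log (hpos x hx), Real.exp_log (hpos y hy)]
      congr 2; ring
  refine dual_properties h.1 hcomm ?_ h.2.1 h.2.2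
  intro x y _ _ _ _
  simp [TNorm.joe, TConorm.joe]

/-! ### Ali–Mikhail–Haq -/

theorem aliMikhailHaq_zero_left (α x : ℝ) : TNorm.aliMikhailHaq α 0 x = 0 := by
  simp [TNorm.aliMikhailHaq]

theorem aliMikhailHaq_of_pos {α x y : ℝ} (hx : 0 < x) :
    TNorm.aliMikhailHaq α x y = x * y / (α + (1 - α) * (x + y - x * y)) :=
  if_pos (lt_max_of_lt_left hx)

/-- With `s = x + y - x * y` in `(0, 1]` the denominator is `s + α * (1 - s)`. Some argument must be
positive: for `α = 0` it vanishes at the origin. -/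
theorem aliMikhailHaq_denom_pos {α x y : ℝ} (h0 : 0 ≤ α) (hx : 0 < x) (hx1 : x ≤ 1)
    (hy : 0 ≤ y) (hy1 : y ≤ 1) : 0 < α + (1 - α) * (x + y - x * y) := by
  have h1 : 0 < x + y - x * y := by nlinarith
  have h2 : x + y - x * y ≤ 1 := by nlinarith
  nlinarith

/-- Cross-multiplied monotonicity in `x` of the weight in `aliMikhailHaq_sub`, with `c = 1 - w` and
`d = 1 - z`. With `θ = 1 - α`, for `θ ≥ 0` it is a product of two inequalities, each pairing one
factor of the numerator with one of the denominator. For `θ ≤ 0` the numerator increases, thanks to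
`α ≤ 2`, and the denominator decreases. -/
theorem aliMikhailHaq_weight_mono {α x y c d : ℝ} (h0 : 0 ≤ α) (h2 : α ≤ 2)
    (hx : 0 ≤ x) (hxy : x ≤ y) (hy : y ≤ 1)
    (hc0 : 0 ≤ c) (hc : c ≤ 1) (hd0 : 0 ≤ d) (hd : d ≤ 1) :
    x * (1 - (1 - α) * (1 - x)) * ((1 - (1 - α) * (1 - y) * c) * (1 - (1 - α) * (1 - y) * d)) ≤
      y * (1 - (1 - α) * (1 - y)) *
        ((1 - (1 - α) * (1 - x) * c) * (1 - (1 - α) * (1 - x) * d)) := by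
  have hy0 := hx.trans hxy
  obtain ⟨θ, rfl⟩ : ∃ θ, α = 1 - θ := ⟨1 - α, by ring⟩
  simp only [sub_sub_cancel]
  rcases le_total 0 θ with hθ | hθ
  · have hθ1 : θ ≤ 1 := by linarith
    have aux : ∀ u v : ℝ, 0 ≤ u → u ≤ 1 → 0 ≤ v → v ≤ 1 → 0 ≤ 1 - θ * (1 - u) * v := by
      intro u v hu hu1 hv hv1
      have h1 : θ * (1 - u) ≤ 1 := mul_le_one₀ hθ1 (by linarith) (by linarith)
      have h2 : θ * (1 - u) * v ≤ 1 := mul_le_one₀ h1 hv hv1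
      linarith
    have e1 : x * (1 - θ * (1 - y) * c) ≤ y * (1 - θ * (1 - x) * c) := by
      have : θ * c ≤ 1 := mul_le_one₀ hθ1 hc0 hc
      nlinarith [mul_nonneg (sub_nonneg.2 hxy) (sub_nonneg.2 this)]
    have e2 : (1 - θ * (1 - x)) * (1 - θ * (1 - y) * d) ≤
        (1 - θ * (1 - y)) * (1 - θ * (1 - x) * d) := by
      nlinarith [mul_nonneg hθ (mul_nonneg (sub_nonneg.2 hd) (sub_nonneg.2 hxy))]
    have p1 : 0 ≤ 1 - θ * (1 - x) := by simpa using aux x 1 hx (by linarith) zero_le_one le_rfl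
    have := mul_le_mul e1 e2 (mul_nonneg p1 (aux y d hy0 hy hd0 hd))
      (mul_nonneg hy0 (aux x c hx (by linarith) hc0 hc))
    linarith
  · obtain ⟨κ, rfl⟩ : ∃ κ, θ = -κ := ⟨-θ, by ring⟩
    have hκ : 0 ≤ κ := by linarith
    have hκ1 : κ ≤ 1 := by linarith
    have hx' : 0 ≤ 1 - x := by linarith
    have hy' : 0 ≤ 1 - y := by linarith
    simp only [neg_mul, sub_neg_eq_add]
    have e1 : x * (1 + κ * (1 - x)) ≤ y * (1 + κ * (1 - y)) := by
      nlinarith [mul_nonneg (sub_nonneg.2 hxy) (sub_nonneg.2 hκ1),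
        mul_nonneg hκ (mul_nonneg (sub_nonneg.2 hxy) (by linarith : 0 ≤ 2 - x - y))]
    have e2 : ∀ v : ℝ, 0 ≤ v → 1 + κ * (1 - y) * v ≤ 1 + κ * (1 - x) * v := by
      intro v hv; gcongr
    refine mul_le_mul e1 (mul_le_mul (e2 c hc0) (e2 d hd0) ?_ ?_) ?_ ?_ <;> positivity

theorem aliMikhailHaq_propertyA {α : ℝ} (h0 : 0 ≤ α) (h2 : α ≤ 2)
    (hmap : MapsUnitSquare (TNorm.aliMikhailHaq α)) : PropertyA (TNorm.aliMikhailHaq α) := by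
  intro x y z w hx hxy hyz hzw hw h
  rcases hx.eq_or_lt with rfl | hx
  · rw [aliMikhailHaq_zero_left]
    exact (hmap y z hxy (by linarith) (by linarith) (by linarith)).1
  have hy := hx.trans_le hxy
  have hz := hy.trans_le hyz
  have hw0 := hz.trans_le hzw
  rw [aliMikhailHaq_of_pos hx, aliMikhailHaq_of_pos hy, div_le_div_iff₀
    (aliMikhailHaq_denom_pos h0 hx (by linarith) hw0.le hw)
    (aliMikhailHaq_denom_pos h0 hy (by linarith) hz.le (by linarith))]
  have hP := mul_le_mul_of_add_le_add_of_le hx.le hxy hyz hzw h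
  have hQ : x * w * (y + z) ≤ y * z * (x + w) := by
    have k1 : x * y * (w - z) ≤ z * w * (y - x) := by
      have k2 : x * y ≤ z * w := by gcongr <;> linarith
      exact mul_le_mul k2 (by linarith) (by linarith) (by positivity)
    linarith
  -- Let `P` and `Q` be the differences of the sides in `hP` and `hQ`. Clearing denominators leaves
  -- `0 ≤ α * P + (1 - α) * Q`; for `α ≥ 1` the bound `Q ≤ 2 * P` reduces this to `(2 - α) * P ≥ 0`.
  have hQ2 : y * z * (x + w) - x * w * (y + z) ≤ 2 * (y * z - x * w) := by
    nlinarith [mul_nonneg (sub_nonneg.2 hP) (by linarith : 0 ≤ 2 - (x + w)),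
      mul_nonneg (mul_nonneg hx.le hw0.le) (by linarith : 0 ≤ y + z - (w + x))]
  rcases le_total α 1 with h1 | h1
  · nlinarith [mul_nonneg h0 (sub_nonneg.2 hP), mul_nonneg (sub_nonneg.2 h1) (sub_nonneg.2 hQ)]
  · nlinarith [mul_nonneg (sub_nonneg.2 h1) (sub_nonneg.2 hQ2),
      mul_nonneg (sub_nonneg.2 h2) (sub_nonneg.2 hP)]

/-- Factoring out `w - z` reduces `B` to monotonicity in `x` of the remaining weight. -/
theorem aliMikhailHaq_sub {α x z w : ℝ} (h0 : 0 ≤ α) (hx : 0 < x) (hx1 : x ≤ 1)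
    (hz : 0 ≤ z) (hz1 : z ≤ 1) (hw : 0 ≤ w) (hw1 : w ≤ 1) :
    TNorm.aliMikhailHaq α x w - TNorm.aliMikhailHaq α x z =
      (w - z) * (x * (1 - (1 - α) * (1 - x)) /
        ((1 - (1 - α) * (1 - x) * (1 - w)) * (1 - (1 - α) * (1 - x) * (1 - z)))) := by
  have e : ∀ v, α + (1 - α) * (x + v - x * v) = 1 - (1 - α) * (1 - x) * (1 - v) := by
    intro v; ring
  have p1 := aliMikhailHaq_denom_pos h0 hx hx1 hz hz1
  have p2 := aliMikhailHaq_denom_pos h0 hx hx1 hw hw1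
  rw [aliMikhailHaq_of_pos hx, aliMikhailHaq_of_pos hx]
  rw [e] at p1 p2 ⊢
  rw [e, div_sub_div _ _ p2.ne' p1.ne', mul_div_assoc']
  congr 1
  ring

theorem aliMikhailHaq_propertyB {α : ℝ} (h0 : 0 ≤ α) (h2 : α ≤ 2) :
    PropertyB (TNorm.aliMikhailHaq α) := by
  have hmono : ∀ x z w, 0 ≤ x → x ≤ 1 → 0 ≤ z → z ≤ w → w ≤ 1 →
      0 ≤ TNorm.aliMikhailHaq α x w - TNorm.aliMikhailHaq α x z := by
    intro x z w hx hx1 hz hzw hw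
    rcases hx.eq_or_lt with rfl | hx
    · rw [aliMikhailHaq_zero_left, aliMikhailHaq_zero_left, sub_zero]
    rw [aliMikhailHaq_sub h0 hx hx1 hz (hzw.trans hw) (hz.trans hzw) hw]
    have p1 := aliMikhailHaq_denom_pos h0 hx hx1 hz (hzw.trans hw)
    have p2 := aliMikhailHaq_denom_pos h0 hx hx1 (hz.trans hzw) hw
    -- The second factor of the numerator is the denominator at second argument `0`.
    have p3 := aliMikhailHaq_denom_pos h0 hx hx1 le_rfl zero_le_one
    refine mul_nonneg (by linarith) (div_nonneg (mul_nonneg hx.le ?_) (mul_nonneg ?_ ?_)) <;>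
      linarith
  intro x y z w hx hxy hy hz hzw hw
  rcases hx.eq_or_lt with rfl | hx
  · rw [aliMikhailHaq_zero_left, aliMikhailHaq_zero_left, sub_zero]
    exact hmono y z w hxy hy hz hzw hw
  have hy0 := hx.trans_le hxy
  have hx1 := hxy.trans hy
  have hz1 := hzw.trans hw
  have hw0 := hz.trans hzw
  rw [aliMikhailHaq_sub h0 hx hx1 hz hz1 hw0 hw, aliMikhailHaq_sub h0 hy0 hy hz hz1 hw0 hw]
  refine mul_le_mul_of_nonneg_left ?_ (sub_nonneg.2 hzw)
  have p1 := aliMikhailHaq_denom_pos h0 hx hx1 hz hz1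
  have p2 := aliMikhailHaq_denom_pos h0 hx hx1 hw0 hw
  have p3 := aliMikhailHaq_denom_pos h0 hy0 hy hz hz1
  have p4 := aliMikhailHaq_denom_pos h0 hy0 hy hw0 hw
  rw [div_le_div_iff₀ (mul_pos (by linarith) (by linarith)) (mul_pos (by linarith) (by linarith))]
  exact aliMikhailHaq_weight_mono h0 h2 hx.le hxy hy (by linarith) (by linarith) (by linarith)
    (by linarith)

theorem aliMikhailHaq_case {α : ℝ} (h0 : 0 ≤ α) (h2 : α ≤ 2) :
      DualPair (TNorm.aliMikhailHaq α) (TConorm.aliMikhailHaq α) ∧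
      PropertyA (TNorm.aliMikhailHaq α) ∧ PropertyB (TNorm.aliMikhailHaq α) ∧
      PropertyA' (TConorm.aliMikhailHaq α) ∧ PropertyB' (TConorm.aliMikhailHaq α) := by
  have hmap : MapsUnitSquare (TNorm.aliMikhailHaq α) := by
    intro x y hx hx1 hy hy1
    rcases hx.eq_or_lt with rfl | hx
    · rw [aliMikhailHaq_zero_left]; simp
    have p := aliMikhailHaq_denom_pos h0 hx hx1 hy hy1
    rw [aliMikhailHaq_of_pos hx]
    refine ⟨by positivity, (div_le_one p).2 ?_⟩
    have a1 : x * y ≤ 1 := mul_le_one₀ hx1 hy hy1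
    have a2 : x * y ≤ x := mul_le_of_le_one_right hx.le hy1
    have a3 : x * y ≤ y := mul_le_of_le_one_left hy hx1
    nlinarith [mul_nonneg (sub_nonneg.2 hx1) (sub_nonneg.2 hy1)]
  refine dual_properties hmap (fun x y => ?_) ?_ (aliMikhailHaq_propertyA h0 h2 hmap)
    (aliMikhailHaq_propertyB h0 h2)
  · unfold TNorm.aliMikhailHaq
    rw [max_comm, mul_comm x, add_comm x]
  · intro x y hx hx1 hy hy1
    unfold TNorm.aliMikhailHaq TConorm.aliMikhailHaq
    by_cases h : min x y < 1
    · have h' : max (1 - x) (1 - y) > 0 := by grind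
      rw [if_pos h, if_pos h']
      have e : α + (1 - α) * (1 - x + (1 - y) - (1 - x) * (1 - y)) = 1 + (α - 1) * x * y := by
        ring
      have p : 0 < 1 + (α - 1) * x * y := by
        rw [← e]
        rcases hx1.eq_or_lt with rfl | hx1
        · have hy1 : y < 1 := by grind
          nlinarith
        · exact aliMikhailHaq_denom_pos h0 (by linarith) (by linarith) (by linarith) (by linarith)
      rw [e, eq_sub_iff_add_eq, ← add_div, div_eq_one_iff_eq p.ne']
      ring
    · have h' : ¬ max (1 - x) (1 - y) > 0 := by grind
      rw [if_neg h, if_neg h', sub_zero]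

/-! ### Frank -/

/-- With `g x = (α ^ x - 1) / (α - 1)`, which maps `[0,1]` increasingly onto itself whether `α < 1`
or `α > 1`, this is `g⁻¹ (g x * g y)`. -/
theorem frank_eq {α x y : ℝ} (h1 : α ≠ 1) : TNorm.frank α x y =
    Real.logb α (1 + (α - 1) * (((α ^ x - 1) / (α - 1)) * ((α ^ y - 1) / (α - 1)))) := by
  have : α - 1 ≠ 0 := sub_ne_zero.2 h1
  unfold TNorm.frank
  congr 2
  field_simp

theorem frank_generator_mono {α x y : ℝ} (h0 : 0 < α) (h1 : α ≠ 1) (hxy : x ≤ y) :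
    (α ^ x - 1) / (α - 1) ≤ (α ^ y - 1) / (α - 1) := by
  rcases h1.lt_or_gt with h | h
  · exact div_le_div_of_nonpos_of_le (by linarith)
      (sub_le_sub_right (Real.rpow_le_rpow_of_exponent_ge h0 h.le hxy) _)
  · exact div_le_div_of_nonneg_right
      (sub_le_sub_right (Real.rpow_le_rpow_of_exponent_le h.le hxy) _) (by linarith)

theorem frank_outer_pos {α s : ℝ} (h0 : 0 < α) (hs : 0 ≤ s) (hs1 : s ≤ 1) :
    0 < 1 + (α - 1) * s := by
  rcases hs.eq_or_lt with rfl | hs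
  · simp
  · nlinarith [mul_pos h0 hs]

theorem frank_outer_mono {α s t : ℝ} (h0 : 0 < α) (h1 : α ≠ 1) (hs : 0 ≤ s) (hst : s ≤ t)
    (ht : t ≤ 1) : Real.logb α (1 + (α - 1) * s) ≤ Real.logb α (1 + (α - 1) * t) := by
  have ps := frank_outer_pos h0 hs (hst.trans ht)
  have pt := frank_outer_pos h0 (hs.trans hst) ht
  rcases h1.lt_or_gt with h | h
  · rw [Real.logb_le_logb_of_base_lt_one h0 h ps pt]
    nlinarith
  · rw [Real.logb_le_logb h ps pt]
    nlinarith

theorem frank_case {α : ℝ} (h0 : 0 < α) (h1 : α ≠ 1) :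
      DualPair (TNorm.frank α) (TConorm.frank α) ∧
      PropertyA (TNorm.frank α) ∧ PropertyB (TNorm.frank α) ∧
      PropertyA' (TConorm.frank α) ∧ PropertyB' (TConorm.frank α) := by
  have hc : α - 1 ≠ 0 := sub_ne_zero.2 h1
  have hmono : ∀ {x y : ℝ}, x ≤ y → (α ^ x - 1) / (α - 1) ≤ (α ^ y - 1) / (α - 1) :=
    frank_generator_mono h0 h1
  have hpow : ∀ x : ℝ, 1 + (α - 1) * ((α ^ x - 1) / (α - 1)) = α ^ x := by
    intro x; field_simp; ring
  have hzero : (α ^ (0 : ℝ) - 1) / (α - 1) = 0 := by simp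
  have hone : (α ^ (1 : ℝ) - 1) / (α - 1) = 1 := by rw [Real.rpow_one, div_self hc]
  have hnn : ∀ x : ℝ, 0 ≤ x → 0 ≤ (α ^ x - 1) / (α - 1) := fun x hx =>
    hzero.symm.trans_le (hmono hx)
  have hle : ∀ x : ℝ, x ≤ 1 → (α ^ x - 1) / (α - 1) ≤ 1 := fun x hx =>
    (hmono hx).trans_eq hone
  refine dual_properties ?_ (fun x y => ?_) (fun x y _ _ _ _ => rfl) ?_ ?_
  · intro x y hx hx1 hy hy1
    rw [frank_eq h1]
    have a1 := mul_nonneg (hnn x hx) (hnn y hy)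
    have a2 := mul_le_one₀ (hle x hx1) (hnn y hy) (hle y hy1)
    have b1 := frank_outer_mono h0 h1 le_rfl a1 a2
    have b2 := frank_outer_mono h0 h1 a1 a2 le_rfl
    rw [mul_zero, add_zero, Real.logb_one] at b1
    rw [mul_one, add_sub_cancel, Real.logb_self_eq_one_iff.2
      ⟨h0.ne', h1, by linarith⟩] at b2
    exact ⟨b1, b2⟩
  · unfold TNorm.frank; rw [mul_comm]
  · intro x y z w hx hxy hyz hzw hw h
    rw [frank_eq h1, frank_eq h1]
    have g := hmono h
    rw [Real.rpow_add h0, Real.rpow_add h0, ← hpow x, ← hpow y, ← hpow z, ← hpow w] at g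
    have q := Real.rpow_pos_of_pos h0 w
    rw [← hpow w] at q
    have m1 := hmono hyz
    have m2 := hmono hzw
    have n1 := hnn x hx
    have n2 := hnn w (by linarith)
    have n3 := hnn y (by linarith)
    have n4 := hnn z (by linarith)
    have l1 := hle y (by linarith)
    have l2 := hle z (by linarith)
    generalize (α ^ x - 1) / (α - 1) = a at *
    generalize (α ^ y - 1) / (α - 1) = b at *
    generalize (α ^ z - 1) / (α - 1) = c at *
    generalize (α ^ w - 1) / (α - 1) = d at *
    refine frank_outer_mono h0 h1 (mul_nonneg n1 n2) ?_ (mul_le_one₀ l1 n4 l2)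
    have e : ∀ u v : ℝ, ((1 + (α - 1) * u) * (1 + (α - 1) * v) - 1) / (α - 1) =
        u + v + (α - 1) * u * v := by
      intro u v; field_simp; ring
    rw [e, e] at g
    -- Multiplying by `α ^ w = 1 + (α - 1) * d` makes the claim linear in the hints: `(b * c - a *
    -- d) * (1 + (α - 1) * d)` equals `d` times the gap in `g` plus `(d - b) * (d - c)`.
    refine le_of_mul_le_mul_right ?_ q
    nlinarith [mul_le_mul_of_nonneg_right g n2,
      mul_nonneg (sub_nonneg.2 (m1.trans m2)) (sub_nonneg.2 m2)]
  · intro x y z w hx hxy hy hz hzw hw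
    simp only [frank_eq h1]
    have m1 := hmono hxy
    have m2 := hmono hzw
    have n1 := hnn x hx
    have n2 := hnn w (by linarith)
    have n3 := hnn y (by linarith)
    have n4 := hnn z (by linarith)
    have l1 := hle x (by linarith)
    have l2 := hle y (by linarith)
    have l3 := hle z (by linarith)
    have l4 := hle w (by linarith)
    generalize (α ^ x - 1) / (α - 1) = a at *
    generalize (α ^ y - 1) / (α - 1) = b at *
    generalize (α ^ z - 1) / (α - 1) = c at *
    generalize (α ^ w - 1) / (α - 1) = d at *
    have p1 := frank_outer_pos h0 (mul_nonneg n1 n2) (mul_le_one₀ l1 n2 l4)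
    have p2 := frank_outer_pos h0 (mul_nonneg n1 n4) (mul_le_one₀ l1 n4 l3)
    have p3 := frank_outer_pos h0 (mul_nonneg n3 n2) (mul_le_one₀ l2 n2 l4)
    have p4 := frank_outer_pos h0 (mul_nonneg n3 n4) (mul_le_one₀ l2 n4 l3)
    have key : 0 ≤ (b - a) * (d - c) := mul_nonneg (sub_nonneg.2 m1) (sub_nonneg.2 m2)
    -- The logarithm turns `B` into a comparison of two products whose difference has the sign of `α
    -- - 1`, exactly matching the direction of monotonicity of `logb α`.
    have e : (1 + (α - 1) * (b * d)) * (1 + (α - 1) * (a * c)) =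
      (1 + (α - 1) * (a * d)) * (1 + (α - 1) * (b * c)) + (α - 1) * ((b - a) * (d - c)) := by
      ring
    have goal : Real.logb α ((1 + (α - 1) * (a * d)) * (1 + (α - 1) * (b * c))) ≤
        Real.logb α ((1 + (α - 1) * (b * d)) * (1 + (α - 1) * (a * c))) := by
      rcases h1.lt_or_gt with h | h
      · rw [Real.logb_le_logb_of_base_lt_one h0 h (mul_pos p1 p4) (mul_pos p3 p2), e]
        nlinarith
      · rw [Real.logb_le_logb h (mul_pos p1 p4) (mul_pos p3 p2), e]
        nlinarith
    rw [Real.logb_mul p1.ne' p4.ne', Real.logb_mul p3.ne' p2.ne'] at goal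
    linarith

theorem mainTheorem6 :
    (DualPair TNorm.minimum TConorm.maximum ∧
      PropertyA TNorm.minimum ∧ PropertyB TNorm.minimum ∧
      PropertyA' TConorm.maximum ∧ PropertyB' TConorm.maximum) ∧
    (DualPair TNorm.product TConorm.probabilisticSum ∧
      PropertyA TNorm.product ∧ PropertyB TNorm.product ∧
      PropertyA' TConorm.probabilisticSum ∧ PropertyB' TConorm.probabilisticSum) ∧
    (DualPair TNorm.lukasiewicz TConorm.boundedSum ∧
      PropertyA TNorm.lukasiewicz ∧ PropertyB TNorm.lukasiewicz ∧
      PropertyA' TConorm.boundedSum ∧ PropertyB' TConorm.boundedSum) ∧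
    (DualPair TNorm.drastic TConorm.drastic ∧
      ¬ PropertyA TNorm.drastic ∧ ¬ PropertyB TNorm.drastic ∧
      ¬ PropertyA' TConorm.drastic ∧ ¬ PropertyB' TConorm.drastic) ∧
    (DualPair TNorm.nilpotentMin TConorm.nilpotentMax ∧
      PropertyA TNorm.nilpotentMin ∧ ¬ PropertyB TNorm.nilpotentMin ∧
      PropertyA' TConorm.nilpotentMax ∧ ¬ PropertyB' TConorm.nilpotentMax) ∧
    (∀ α : ℝ, 0 ≤ α → α ≤ 1 →
      DualPair (TNorm.duboisPrade α) (TConorm.duboisPrade α) ∧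
      PropertyA (TNorm.duboisPrade α) ∧ PropertyB (TNorm.duboisPrade α) ∧
      PropertyA' (TConorm.duboisPrade α) ∧ PropertyB' (TConorm.duboisPrade α)) ∧
    (∀ α : ℝ, 0 ≤ α → α ≤ 2 →
      DualPair (TNorm.aliMikhailHaq α) (TConorm.aliMikhailHaq α) ∧
      PropertyA (TNorm.aliMikhailHaq α) ∧ PropertyB (TNorm.aliMikhailHaq α) ∧
      PropertyA' (TConorm.aliMikhailHaq α) ∧ PropertyB' (TConorm.aliMikhailHaq α)) ∧
    (∀ α : ℝ, α ≠ 0 → α ≤ 1 →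
      DualPair (TNorm.clayton α) (TConorm.clayton α) ∧
      PropertyA (TNorm.clayton α) ∧ PropertyB (TNorm.clayton α) ∧
      PropertyA' (TConorm.clayton α) ∧ PropertyB' (TConorm.clayton α)) ∧
    (∀ α : ℝ, 0 < α → α ≠ 1 →
      DualPair (TNorm.frank α) (TConorm.frank α) ∧
      PropertyA (TNorm.frank α) ∧ PropertyB (TNorm.frank α) ∧
      PropertyA' (TConorm.frank α) ∧ PropertyB' (TConorm.frank α)) ∧
    (∀ α : ℝ, 1 ≤ α →
      DualPair (TNorm.yager α) (TConorm.yager α) ∧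
      PropertyA (TNorm.yager α) ∧ PropertyB (TNorm.yager α) ∧
      PropertyA' (TConorm.yager α) ∧ PropertyB' (TConorm.yager α)) ∧
    (∀ α : ℝ, 0 ≤ α → α ≤ 1 →
      DualPair (TNorm.mayorTorrens α) (TConorm.mayorTorrens α) ∧
      PropertyA (TNorm.mayorTorrens α) ∧ PropertyB (TNorm.mayorTorrens α) ∧
      PropertyA' (TConorm.mayorTorrens α) ∧ PropertyB' (TConorm.mayorTorrens α)) ∧
    (∀ α : ℝ, 0 ≤ α →
      DualPair (TNorm.sugenoWeber α) (TConorm.sugenoWeber α) ∧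
      PropertyA (TNorm.sugenoWeber α) ∧ PropertyB (TNorm.sugenoWeber α) ∧
      PropertyA' (TConorm.sugenoWeber α) ∧ PropertyB' (TConorm.sugenoWeber α)) ∧
    (∀ α : ℝ, 1 ≤ α →
      DualPair (TNorm.gumbel α) (TConorm.gumbel α) ∧
      PropertyA (TNorm.gumbel α) ∧ PropertyB (TNorm.gumbel α) ∧
      PropertyA' (TConorm.gumbel α) ∧ PropertyB' (TConorm.gumbel α)) ∧
    (∀ α : ℝ, 1 ≤ α →
      DualPair (TNorm.joe α) (TConorm.joe α) ∧
      PropertyA (TNorm.joe α) ∧ PropertyB (TNorm.joe α) ∧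
      PropertyA' (TConorm.joe α) ∧ PropertyB' (TConorm.joe α)) := by
  exact ⟨minimum_case, product_case, lukasiewicz_case, drastic_case, nilpotent_case,
    fun _ => duboisPrade_case, fun _ => aliMikhailHaq_case, fun _ => clayton_case,
    fun _ => frank_case, fun _ => yager_case, fun _ h _ => mayorTorrens_case h,
    fun _ => sugenoWeber_case, fun _ => gumbel_case, fun _ => joe_case⟩
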